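/- Let $G=(V,E)$ be a finite graph (loops and parallel edges allowed), let $d\ge 1$, let $\mathbb F$ be a field and let $K$ be an infinite extension field of $\mathbb F$ (for instance $K=\mathbb F$ if $\mathbb F$ is infinite, or $K=\overline{\mathbb F}$ for any $\mathbb F$). A picture $P$ of $G$ consists of a point $P(v)\in\mathbb P^d(K)$ for each vertex $v$ and a line $P(e)\subset\mathbb P^d(K)$ for each edge $e$, such that $P(v)\in P(e)$ whenever $v$ is an endpoint of $e$. The set $\mathrm{PS}(G)$ of all pictures carries the Zariski topology, whose closed sets are the common zero sets of polynomials with coefficients in $\mathbb F$ in the homogeneous coordinates of the points and the Plücker coordinates of the lines, homogeneous separately in the coordinates of each point and each line. For a partition $\pi$ of $V$, the cellule $\mathrm{PS}_\pi(G)$ is the set of pictures such that $P(v)=P(w)$ if and only if $v,w$ lie in the same block of $\pi$. The cellule order is defined by $\pi\prec\sigma$ if and only if $\mathrm{PS}_\pi(G)\subseteq\overline{\mathrm{PS}_\sigma(G)}$, and the cellule indexed by $\pi$ is called maximal if $\pi\prec\sigma$ implies $\sigma\prec\pi$ for all partitions $\sigma$ of $V$. (1) Let $\emptyset\neq S\subseteq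 V$ and $y\in V\setminus S$ be such that at most one edge (counted with multiplicity) joins $y$ to a vertex of $S$. Let $\pi$ be a partition of $V$ having $S'=S\cup\{y\}$ as a block, and let $\sigma=(\pi\setminus\{S'\})\cup\{S,\{y\}\}$. Then $\mathrm{PS}_\pi(G)\subseteq\overline{\mathrm{PS}_\sigma(G)}$. (2) In particular, if $\pi$ has a block $\{x,y\}$ with $x\ne y$ and at most one edge of $G$ joins $x$ and $y$, then $\pi$ does not index a maximal cellule. Hence, if $G$ is simple, then no partition with a block of size two indexes a maximal cellule. -/

import Mathlib

open scoped LinearAlgebra.Projectivization Topology Graph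

namespace GraphPicture

/-- A point of projective `d`-space over `K`. -/
abbrev ProjPoint (K : Type*) [Field K] (d : ℕ) : Type _ := ℙ K (Fin (d + 1) → K)

/-- A line of projective `d`-space over `K`: a two-dimensional linear subspace of `K ^ (d + 1)`. -/
abbrev ProjLine (K : Type*) [Field K] (d : ℕ) : Type _ :=
  {L : Submodule K (Fin (d + 1) → K) // Module.finrank K L = 2}

/-- A picture of the (multi)graph `G` in projective `d`-space over `K`: a point for every vertex
and a line for every edge, the line of an edge passing through the points of its ends. -/
@[ext]
structure Picture {α β : Type*} (G : Graph α β) (K : Type*) [Field K] (d : ℕ) where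
  point : V(G) → ProjPoint K d
  line : E(G) → ProjLine K d
  incident : ∀ (e : E(G)) (v : V(G)), G.Inc e v → (point v).submodule ≤ (line e).1

/-- Indices of the homogeneous coordinates of a picture: coordinates `(v, i)` of the point of the
vertex `v`, and Plücker coordinates `(e, i, j)` of the line of the edge `e`. -/
abbrev CoordIndex {α β : Type*} (G : Graph α β) (d : ℕ) : Type _ :=
  (V(G) × Fin (d + 1)) ⊕ (E(G) × Fin (d + 1) × Fin (d + 1))

/-- `c` is a system of homogeneous coordinates of the picture `P`: homogeneous coordinates of each
point and Plücker coordinates (two-by-two minors of a basis) of each line. -/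
def IsCoordinates {α β : Type*} {G : Graph α β} {K : Type*} [Field K] {d : ℕ}
    (P : Picture G K d) (c : CoordIndex G d → K) : Prop :=
  (∀ v : V(G), ∃ h : (fun i => c (Sum.inl (v, i))) ≠ 0,
    Projectivization.mk K (fun i => c (Sum.inl (v, i))) h = P.point v) ∧
  (∀ e : E(G), ∃ a b : Fin (d + 1) → K, (P.line e).1 = Submodule.span K {a, b} ∧
    ∀ i j, c (Sum.inr (e, i, j)) = a i * b j - a j * b i)

/-- The multidegree of a coordinate: one degree for every vertex and every edge. -/
noncomputable def multidegree {α β : Type*} (G : Graph α β) (d : ℕ) :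
    CoordIndex G d → ((V(G) ⊕ E(G)) →₀ ℕ)
  | Sum.inl (v, _) => Finsupp.single (Sum.inl v) 1
  | Sum.inr (e, _, _) => Finsupp.single (Sum.inr e) 1

/-- The polynomial `f` is multihomogeneous, i.e. homogeneous separately in the coordinates of each
point and in those of each line. -/
def IsMultihomogeneous {α β : Type*} (F : Type*) [Field F] {G : Graph α β} {d : ℕ}
    (f : MvPolynomial (CoordIndex G d) F) : Prop :=
  ∃ m : (V(G) ⊕ E(G)) →₀ ℕ, f.IsWeightedHomogeneous (multidegree G d) m

/-- The set of pictures over `K` at which the polynomial `f` over `F` vanishes.  For a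
multihomogeneous `f` the choice of the homogeneous coordinates does not matter. -/
def zeroLocus {α β : Type*} {F : Type*} (K : Type*) [Field F] [Field K] [Algebra F K]
    {G : Graph α β} {d : ℕ} (f : MvPolynomial (CoordIndex G d) F) : Set (Picture G K d) :=
  {P | ∀ c, IsCoordinates P c → MvPolynomial.aeval c f = 0}

/-- The Zariski topology on the picture space, as a subspace of the product of the projective
spaces and Grassmannians: the complements of the zero loci of multihomogeneous polynomials with
coefficients in `F` are a basis of open sets.  For `K = F` this is the classical topology on the
`F`-rational points; for `K` an algebraic closure of `F`, closed sets correspond to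
closed subsets of the picture space regarded as a reduced scheme over `F`. -/
abbrev zariski {α β : Type*} (G : Graph α β) (F K : Type*) [Field F] [Field K] [Algebra F K]
    (d : ℕ) : TopologicalSpace (Picture G K d) :=
  TopologicalSpace.generateFrom
    {U | ∃ f : MvPolynomial (CoordIndex G d) F, IsMultihomogeneous F f ∧ U = (zeroLocus K f)ᶜ}

/-- The cellule of a partition `π` of the vertex set, given by its equivalence relation. -/
def cellule {α β : Type*} {G : Graph α β} (K : Type*) [Field K] (d : ℕ) (π : Setoid V(G)) :
    Set (Picture G K d) :=
  {P | ∀ v w : V(G), P.point v = P.point w ↔ π v w}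

/-- The Zariski closure of the cellule of `π` in the picture space. -/
def celluleClosure {α β : Type*} {G : Graph α β} (F K : Type*) [Field F] [Field K] [Algebra F K]
    (d : ℕ) (π : Setoid V(G)) : Set (Picture G K d) :=
  closure[zariski G F K d] (cellule K d π)

/-- The cellule order: `π` is below `σ` if the cellule of `π` lies in the closure of that
of `σ`. -/
def CelluleLE {α β : Type*} {G : Graph α β} (F K : Type*) [Field F] [Field K] [Algebra F K]
    (d : ℕ) (π σ : Setoid V(G)) : Prop :=
  cellule K d π ⊆ celluleClosure F K d σ

/-- The partition `π` indexes a maximal cellule: nothing is strictly above it in the cellule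
order. -/
def IsMaximalCellule {α β : Type*} {G : Graph α β} (F K : Type*) [Field F] [Field K] [Algebra F K]
    (d : ℕ) (π : Setoid V(G)) : Prop :=
  ∀ σ : Setoid V(G), CelluleLE F K d π σ → CelluleLE F K d σ π

end GraphPicture

/-! Given a picture in the smaller cellule, slide the point of `y` along a line of projective space,
from `p` to `p + t q`. At most one edge joins `y` to the rest of its block; choosing `q` on the line
of that edge lets this line stay put. Any other edge from `y` to a different vertex ends at a
different point, and its line turns about that point; a loop turns about an arbitrary point of its
line. For almost all `t` the result lies in the cellule of `σ` (`cellule_subset_celluleClosure`).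
Homogeneous coordinates are affine in `t`, so a polynomial nonzero at `t = 0` is nonzero for almost
all `t`, and the original picture is a limit (`tendsto_of_linear_coordinates`).

For non-maximality, coincidence of two points is a closed condition
(`point_eq_of_mem_celluleClosure`), while the cellule of `σ` contains a picture that separates them
(`cellule_nonempty`). -/

namespace GraphPicture

/-! ### Planes, independent pairs and their minors -/

section LinearAlgebra

variable {K M : Type*} [Field K] [AddCommGroup M] [Module K M]

theorem finrank_span_pair {a b : M} (h : LinearIndependent K ![a, b]) :
    Module.finrank K (Submodule.span K {a, b}) = 2 := by
  have := finrank_span_eq_card h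
  rwa [Matrix.range_cons_cons_empty, Fintype.card_fin] at this

/-- Two independent vectors in a plane span it. -/
theorem eq_span_pair {L : Submodule K M} (hL : Module.finrank K L = 2) {a b : M}
    (h : LinearIndependent K ![a, b]) (ha : a ∈ L) (hb : b ∈ L) :
    L = Submodule.span K {a, b} := by
  have : FiniteDimensional K L := Module.finite_of_finrank_pos (by omega)
  refine (Submodule.eq_of_le_of_finrank_eq ?_ ?_).symm
  · rw [Submodule.span_le]
    rintro x (rfl | rfl)
    · exact ha
    · exact hb
  · rw [finrank_span_pair h, hL]

theorem exists_linearIndependent_pair {L : Submodule K M} (hL : 2 ≤ Module.finrank K L) {p : M}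
    (hp : p ≠ 0) : ∃ r ∈ L, LinearIndependent K ![p, r] := by
  by_contra! H
  have hle : L ≤ Submodule.span K {p} := by
    intro r hr
    have := H r hr
    rw [LinearIndependent.pair_iff' hp] at this
    push Not at this
    exact Submodule.mem_span_singleton.2 this
  have h1 := Submodule.finrank_mono hle
  rw [finrank_span_singleton hp] at h1
  omega

theorem exists_plane (hM : 2 ≤ Module.finrank K M) {a b : M} (ha : a ≠ 0) :
    ∃ L : Submodule K M, Module.finrank K L = 2 ∧ a ∈ L ∧ b ∈ L := by
  by_cases h : LinearIndependent K ![a, b]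
  · exact ⟨_, finrank_span_pair h, Submodule.subset_span (by simp), Submodule.subset_span (by simp)⟩
  · obtain ⟨r, -, hr⟩ := exists_linearIndependent_pair (L := (⊤ : Submodule K M))
      (by rwa [finrank_top]) ha
    refine ⟨_, finrank_span_pair hr, Submodule.subset_span (by simp), ?_⟩
    rw [LinearIndependent.pair_iff' ha] at h
    push Not at h
    obtain ⟨c, rfl⟩ := h
    exact Submodule.smul_mem _ _ (Submodule.subset_span (by simp))

theorem add_smul_ne_zero {p q : M} (h : LinearIndependent K ![p, q]) (t : K) : p + t • q ≠ 0 := by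
  intro h0
  have := LinearIndependent.pair_iff.1 h 1 t (by simpa using h0)
  exact one_ne_zero this.1

/-- On the affine line `p + t q` all but finitely many vectors are independent of `r`, if `p` is. -/
theorem eventually_linearIndependent {p r : M} (q : M) (h : LinearIndependent K ![p, r]) :
    ∀ᶠ t : K in Filter.cofinite, LinearIndependent K ![p + t • q, r] := by
  have hr : r ≠ 0 := h.ne_zero 1
  have key : ∀ a : M, LinearIndependent K ![a, r] ↔ a ∉ Submodule.span K {r} := by
    intro a
    rw [LinearIndependent.pair_symm_iff, LinearIndependent.pair_iff' hr,
      Submodule.mem_span_singleton]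
    push Not
    rfl
  rw [Filter.eventually_cofinite]
  -- Two bad parameters would put first `q`, then `p`, into the span of `r`.
  refine Set.Subsingleton.finite ?_
  intro t ht s hs
  simp only [Set.mem_ofPred_eq, key, not_not] at ht hs
  by_contra hts
  have h1 : (t - s) • q ∈ Submodule.span K {r} := by
    have := Submodule.sub_mem _ ht hs
    rwa [add_sub_add_left_eq_sub, ← sub_smul] at this
  have h2 : q ∈ Submodule.span K {r} :=
    (Submodule.smul_mem_iff _ (sub_ne_zero.2 hts)).1 h1
  have h3 := Submodule.sub_mem _ ht (Submodule.smul_mem _ t h2)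
  rw [add_sub_cancel_right] at h3
  exact (key p).1 h h3

/-- The Plücker coordinates of a plane are unique up to a nonzero scalar. -/
theorem exists_minors_eq_smul {ι : Type*} {a b p r : ι → K} (hab : LinearIndependent K ![a, b])
    (h : Submodule.span K {a, b} = Submodule.span K {p, r}) :
    ∃ l : K, l ≠ 0 ∧ ∀ i j, a i * b j - a j * b i = l * (p i * r j - p j * r i) := by
  have ha : a ∈ Submodule.span K {p, r} := h ▸ Submodule.subset_span (by simp)
  have hb : b ∈ Submodule.span K {p, r} := h ▸ Submodule.subset_span (by simp)
  obtain ⟨a₁, a₂, ha⟩ := Submodule.mem_span_pair.1 ha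
  obtain ⟨b₁, b₂, hb⟩ := Submodule.mem_span_pair.1 hb
  -- The scalar is the determinant of the change of basis.
  refine ⟨a₁ * b₂ - a₂ * b₁, ?_, ?_⟩
  · intro h0
    have hp : b₂ • a + (-a₂) • b = 0 := by
      rw [← ha, ← hb]
      have : b₂ • (a₁ • p + a₂ • r) + (-a₂) • (b₁ • p + b₂ • r) = (a₁ * b₂ - a₂ * b₁) • p := by
        module
      rw [this, h0, zero_smul]
    have hr : b₁ • a + (-a₁) • b = 0 := by
      rw [← ha, ← hb]
      have : b₁ • (a₁ • p + a₂ • r) + (-a₁) • (b₁ • p + b₂ • r) = -(a₁ * b₂ - a₂ * b₁) • r := by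
        module
      rw [this, h0, neg_zero, zero_smul]
    have h1 := (LinearIndependent.pair_iff.1 hab _ _ hp).2
    have h2 := (LinearIndependent.pair_iff.1 hab _ _ hr).2
    rw [neg_eq_zero] at h1 h2
    apply hab.ne_zero 0
    simp [← ha, h1, h2]
  · intro i j
    simp only [← ha, ← hb, Pi.add_apply, Pi.smul_apply, smul_eq_mul]
    ring

theorem linearIndependent_of_finrank_span_pair {a b : M}
    (h : Module.finrank K (Submodule.span K {a, b}) = 2) : LinearIndependent K ![a, b] := by
  rw [linearIndependent_iff_card_eq_finrank_span, Set.finrank, Matrix.range_cons_cons_empty, h,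
    Fintype.card_fin]

theorem mk_eq_mk_iff_not_linearIndependent {a b : M} (ha : a ≠ 0) (hb : b ≠ 0) :
    Projectivization.mk K a ha = Projectivization.mk K b hb ↔ ¬ LinearIndependent K ![a, b] := by
  rw [Projectivization.mk_eq_mk_iff', LinearIndependent.pair_symm_iff,
    LinearIndependent.pair_iff' hb]
  push Not
  rfl

theorem rep_mem_submodule (p : ℙ K M) : p.rep ∈ p.submodule := by
  rw [Projectivization.submodule_eq]
  exact Submodule.mem_span_singleton_self _

theorem linearIndependent_rep_of_ne {p q : ℙ K M} (h : p ≠ q) :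
    LinearIndependent K ![p.rep, q.rep] := by
  by_contra hl
  rw [← mk_eq_mk_iff_not_linearIndependent p.rep_nonzero q.rep_nonzero, Projectivization.mk_rep,
    Projectivization.mk_rep] at hl
  exact h hl

end LinearAlgebra

/-! ### Moving one vertex off its block -/

section Deformation

variable {α β F K : Type*} [Field F] [Field K] [Algebra F K] {G : Graph α β} {d : ℕ}

/-- If all homogeneous coordinates of `P` extend to a linear family of coordinates of the
pictures `Q t`, then `P` is a limit of the `Q t` in the Zariski topology. -/
theorem tendsto_of_linear_coordinates {P : Picture G K d} {Q : K → Picture G K d}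
    (h : ∀ c, IsCoordinates P c → ∃ D : CoordIndex G d → K,
      ∀ᶠ t in Filter.cofinite, IsCoordinates (Q t) (fun i => c i + t * D i)) :
    Filter.Tendsto Q Filter.cofinite (@nhds _ (zariski G F K d) P) := by
  rw [TopologicalSpace.tendsto_nhds_generateFrom_iff]
  rintro _ ⟨f, -, rfl⟩ hP
  simp only [zeroLocus, Set.mem_compl_iff, Set.mem_ofPred_eq, not_forall] at hP
  obtain ⟨c, hc, hfc⟩ := hP
  obtain ⟨D, hD⟩ := h c hc
  -- Restricting `f` to the family gives a polynomial in one variable, nonzero because its value at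
  -- `0` is `f` at `c`.
  let C : CoordIndex G d → Polynomial K := fun i =>
    Polynomial.C (c i) + Polynomial.X * Polynomial.C (D i)
  have heval : ∀ t, (MvPolynomial.aeval C f).eval t
      = MvPolynomial.aeval (fun i => c i + t * D i) f := by
    intro t
    have := MvPolynomial.map_aeval C (Polynomial.evalRingHom t) f
    rw [Polynomial.coe_evalRingHom] at this
    rw [this, MvPolynomial.aeval_def, MvPolynomial.coe_eval₂Hom]
    congr 1
    · ext a
      simp [Polynomial.algebraMap_apply]
    · ext i
      simp only [C, Polynomial.eval_add, Polynomial.eval_mul, Polynomial.eval_C, Polynomial.eval_X]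
  have hne : MvPolynomial.aeval C f ≠ 0 := by
    intro h0
    have := heval 0
    simp only [h0, Polynomial.eval_zero, zero_mul, add_zero] at this
    exact hfc this.symm
  have hroots : ∀ᶠ t in Filter.cofinite, (MvPolynomial.aeval C f).eval t ≠ 0 := by
    rw [Filter.eventually_cofinite]
    simpa using Polynomial.finite_setOfPred_isRoot hne
  filter_upwards [hroots, hD] with t ht htc hz
  exact ht ((heval t).trans (hz _ htc))

open Classical in
/-- If the point of `y` moves along the line of `p` and `q`, and the lines of the edges in `A` turn
with it around points `r e`, then the moved pictures converge to the original one. -/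
theorem tendsto_of_move {P : Picture G K d} {Q : K → Picture G K d} {y : V(G)} {A : Set E(G)}
    {q : Fin (d + 1) → K} {r : E(G) → Fin (d + 1) → K}
    (hq : LinearIndependent K ![(P.point y).rep, q])
    (hr : ∀ e ∈ A, (P.line e).1 = Submodule.span K {(P.point y).rep, r e})
    (hQ : ∀ᶠ t in Filter.cofinite,
      (Q t).point y = Projectivization.mk K ((P.point y).rep + t • q) (add_smul_ne_zero hq t) ∧
      (∀ v, v ≠ y → (Q t).point v = P.point v) ∧
      (∀ e ∈ A, ((Q t).line e).1 = Submodule.span K {(P.point y).rep + t • q, r e}) ∧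
      ∀ e ∉ A, (Q t).line e = P.line e) :
    Filter.Tendsto Q Filter.cofinite (@nhds _ (zariski G F K d) P) := by
  refine tendsto_of_linear_coordinates fun c hc => ?_
  obtain ⟨hcV, hcE⟩ := hc
  set p := (P.point y).rep
  obtain ⟨m, hm0, hm⟩ : ∃ m : K, m ≠ 0 ∧ ∀ i, c (Sum.inl (y, i)) = m * p i := by
    obtain ⟨h0, h1⟩ := hcV y
    rw [← Projectivization.mk_rep (P.point y), Projectivization.mk_eq_mk_iff'] at h1
    obtain ⟨m, hm⟩ := h1
    refine ⟨m, ?_, fun i => (congrFun hm i).symm⟩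
    rintro rfl
    exact h0 (by simpa using hm.symm)
  have hl : ∀ e : E(G), ∃ l : K, l ≠ 0 ∧ (e ∈ A →
      ∀ i j, c (Sum.inr (e, i, j)) = l * (p i * r e j - p j * r e i)) := by
    intro e
    by_cases h : e ∈ A
    · obtain ⟨a, b, hab, hc⟩ := hcE e
      have hL : Module.finrank K (Submodule.span K {a, b}) = 2 := hab ▸ (P.line e).2
      have hLI : LinearIndependent K ![a, b] := linearIndependent_of_finrank_span_pair hL
      have hspan : Submodule.span K {a, b} = Submodule.span K {p, r e} := hab.symm.trans (hr e h)
      obtain ⟨l, hl0, hl⟩ := exists_minors_eq_smul hLI hspan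
      exact ⟨l, hl0, fun _ i j => (hc i j).trans (hl i j)⟩
    · exact ⟨1, one_ne_zero, fun h' => absurd h' h⟩
  choose l hl0 hl using hl
  -- The coefficient of `t`: the pivots `r e` are fixed, so the minors are affine in the moving
  -- vector. The factors `m` and `l` match the arbitrary scaling of `c`.
  let D : CoordIndex G d → K := Sum.elim (fun k => if k.1 = y then m * q k.2 else 0)
    (fun k => if k.1 ∈ A then l k.1 * (q k.2.1 * r k.1 k.2.2 - q k.2.2 * r k.1 k.2.1) else 0)
  refine ⟨D, ?_⟩
  filter_upwards [hQ] with t ht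
  obtain ⟨hQy, hQv, hQA, hQe⟩ := ht
  refine ⟨fun v => ?_, fun e => ?_⟩
  · by_cases hv : v = y
    · subst hv
      have heq : (fun i => c (Sum.inl (v, i)) + t * D (Sum.inl (v, i))) = m • (p + t • q) := by
        ext i
        simp only [D, Sum.elim_inl, if_true, hm, Pi.smul_apply, Pi.add_apply, smul_eq_mul]
        ring
      simp only [heq, hQy]
      refine ⟨smul_ne_zero hm0 (add_smul_ne_zero hq t), ?_⟩
      rw [Projectivization.mk_eq_mk_iff']
      exact ⟨m, rfl⟩
    · simpa only [D, Sum.elim_inl, if_neg hv, mul_zero, add_zero, hQv v hv] using hcV v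
  · by_cases h : e ∈ A
    · refine ⟨l e • (p + t • q), r e, ?_, fun i j => ?_⟩
      · rw [hQA e h, Submodule.span_insert, Submodule.span_insert,
          Submodule.span_singleton_smul_eq (hl0 e).isUnit]
      · simp only [D, Sum.elim_inr, if_pos h, hl e h, Pi.smul_apply, Pi.add_apply, smul_eq_mul]
        ring
    · simpa only [D, Sum.elim_inr, if_neg h, mul_zero, add_zero, hQe e h] using hcE e

/-- A vertex `y` can be moved off the vertices `S` at the same point, if at most one edge joins it
to them. -/
theorem cellule_subset_celluleClosure [Infinite K] [Finite V(G)] [Finite E(G)] (hd : 1 ≤ d)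
    {π σ : Setoid V(G)} {y : V(G)} (hy : ∀ w, σ y w ↔ y = w)
    (hσ : ∀ v w, v ≠ y → w ≠ y → (σ v w ↔ π v w))
    (hE : {e : β | ∃ x : V(G), x ≠ y ∧ π y x ∧ G.IsLink e y x}.encard ≤ 1) :
    cellule K d π ⊆ celluleClosure F K d σ := by
  classical
  intro P hP
  set E₀ := {e : β | ∃ x : V(G), x ≠ y ∧ π y x ∧ G.IsLink e y x}
  set p := (P.point y).rep with hp_def
  have hp : p ≠ 0 := (P.point y).rep_nonzero
  have hinc : ∀ (e : E(G)) (v : V(G)), G.Inc e v → (P.point v).rep ∈ (P.line e).1 :=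
    fun e v h => P.incident e v h (rep_mem_submodule _)
  -- The bound on `E₀` enters here: a direction can be kept inside one prescribed line, not inside
  -- several.
  obtain ⟨q, hq, hqE⟩ : ∃ q, LinearIndependent K ![p, q] ∧
      ∀ e : E(G), (e : β) ∈ E₀ → q ∈ (P.line e).1 := by
    by_cases h : ∃ e : E(G), (e : β) ∈ E₀
    · obtain ⟨e, he⟩ := h
      obtain ⟨q, hqe, hq⟩ := exists_linearIndependent_pair (P.line e).2.ge hp
      refine ⟨q, hq, fun e' he' => ?_⟩
      rwa [show e' = e from Subtype.ext (Set.encard_le_one_iff.1 hE _ _ he' he)]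
    · obtain ⟨q, -, hq⟩ := exists_linearIndependent_pair
        (L := (⊤ : Submodule K (Fin (d + 1) → K))) (by simpa using hd) hp
      exact ⟨q, hq, fun e he => absurd ⟨e, he⟩ h⟩
  -- The pivot `r` represents the other end of the edge, which is a different point since the edge
  -- is outside `E₀`; for a loop any independent vector of the line serves.
  have hr : ∀ e : E(G), ∃ r, G.Inc e y → (e : β) ∉ E₀ →
      LinearIndependent K ![p, r] ∧ (P.line e).1 = Submodule.span K {p, r} ∧
        ∀ z : V(G), z ≠ y → G.Inc e z → (P.point z).submodule ≤ Submodule.span K {r} := by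
    intro e
    by_cases hey : G.Inc e y
    swap
    · exact ⟨0, fun h => absurd h hey⟩
    by_cases heE : (e : β) ∈ E₀
    · exact ⟨0, fun _ h => absurd heE h⟩
    obtain ⟨z, hz⟩ := id hey
    by_cases hzy : z = y
    · obtain ⟨r, hrL, hr⟩ := exists_linearIndependent_pair (P.line e).2.ge hp
      refine ⟨r, fun _ _ => ⟨hr, eq_span_pair (P.line e).2 hr (hinc e y hey) hrL, ?_⟩⟩
      intro w hw hwe
      rcases hwe.eq_or_eq_of_isLink hz with h | h
      · exact absurd (Subtype.ext h) hw
      · exact absurd (Subtype.ext (h.trans hzy)) hw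
    · have hzV : z ∈ V(G) := hz.right_mem
      have hne : P.point y ≠ P.point ⟨z, hzV⟩ := fun h =>
        heE ⟨⟨z, hzV⟩, fun h' => hzy (congrArg Subtype.val h'), (hP _ _).1 h, hz⟩
      have hr := linearIndependent_rep_of_ne hne
      refine ⟨(P.point ⟨z, hzV⟩).rep, fun _ _ =>
        ⟨hr, eq_span_pair (P.line e).2 hr (hinc e y hey) (hinc e ⟨z, hzV⟩ hz.inc_right), ?_⟩⟩
      intro w hw hwe
      rcases hwe.eq_or_eq_of_isLink hz with h | h
      · exact absurd (Subtype.ext h) hw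
      · obtain rfl : w = ⟨z, hzV⟩ := Subtype.ext h
        exact (Projectivization.submodule_eq _).le
  choose r hr using hr
  have hgood : ∀ᶠ t : K in Filter.cofinite, t ≠ 0 ∧
      (∀ e : E(G), G.Inc e y → (e : β) ∉ E₀ → LinearIndependent K ![p + t • q, r e]) ∧
      ∀ w : V(G), P.point y ≠ P.point w →
        LinearIndependent K ![p + t • q, (P.point w).rep] := by
    refine Filter.Eventually.and ?_ (Filter.Eventually.and ?_ ?_)
    · simp [Filter.eventually_cofinite]
    · rw [Filter.eventually_all]
      intro e
      by_cases h₁ : G.Inc e y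
      · by_cases h₂ : (e : β) ∈ E₀
        · simp [h₂]
        · filter_upwards [eventually_linearIndependent q (hr e h₁ h₂).1] with t ht _ _ using ht
      · simp [h₁]
    · rw [Filter.eventually_all]
      intro w
      by_cases h : P.point y = P.point w
      · simp [h]
      · filter_upwards [eventually_linearIndependent q (linearIndependent_rep_of_ne h)] with t ht _
          using ht
  have hQ : ∀ t : K, ∃ Q : Picture G K d,
      (∀ e : E(G), G.Inc e y → (e : β) ∉ E₀ → LinearIndependent K ![p + t • q, r e]) →
      Q.point y = Projectivization.mk K (p + t • q) (add_smul_ne_zero hq t) ∧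
      (∀ v, v ≠ y → Q.point v = P.point v) ∧
      (∀ e ∈ {e : E(G) | G.Inc e y ∧ (e : β) ∉ E₀},
        (Q.line e).1 = Submodule.span K {p + t • q, r e}) ∧
      ∀ e ∉ {e : E(G) | G.Inc e y ∧ (e : β) ∉ E₀}, Q.line e = P.line e := by
    intro t
    by_cases ht : ∀ e : E(G), G.Inc e y → (e : β) ∉ E₀ → LinearIndependent K ![p + t • q, r e]
    swap
    · exact ⟨P, fun h => absurd h ht⟩
    refine ⟨{
      point := fun v => if v = y then Projectivization.mk K (p + t • q) (add_smul_ne_zero hq t)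
        else P.point v
      line := fun e => if h : G.Inc e y ∧ (e : β) ∉ E₀ then
        ⟨Submodule.span K {p + t • q, r e}, finrank_span_pair (ht e h.1 h.2)⟩ else P.line e
      incident := ?_ }, fun _ => ⟨if_pos rfl, fun v hv => if_neg hv,
        fun e he => congrArg Subtype.val (dif_pos he), fun e he => dif_neg he⟩⟩
    intro e v hev
    by_cases hv : v = y
    · subst hv
      rw [if_pos rfl, Projectivization.submodule_mk, Submodule.span_singleton_le_iff_mem]
      by_cases hE' : (e : β) ∈ E₀
      · rw [dif_neg fun h => h.2 hE']
        exact add_mem (hinc e v hev) (Submodule.smul_mem _ _ (hqE e hE'))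
      · rw [dif_pos ⟨hev, hE'⟩]
        exact Submodule.subset_span (by simp)
    · rw [if_neg hv]
      by_cases h : G.Inc e y ∧ (e : β) ∉ E₀
      · rw [dif_pos h]
        exact ((hr e h.1 h.2).2.2 v hv hev).trans (Submodule.span_mono (by simp))
      · rw [dif_neg h]
        exact P.incident e v hev
  choose Q hQ using hQ
  have htend : Filter.Tendsto Q Filter.cofinite (@nhds _ (zariski G F K d) P) := by
    refine tendsto_of_move (A := {e | G.Inc e y ∧ (e : β) ∉ E₀}) hq
      (fun e he => (hr e he.1 he.2).2.1) ?_
    filter_upwards [hgood] with t ht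
    exact hQ t ht.2.1
  -- The instance is nontriviality of the cofinite filter, which holds because `K` is infinite.
  refine @mem_closure_of_tendsto _ (zariski G F K d) _ _ _ _ _ inferInstance htend ?_
  filter_upwards [hgood] with t ht
  obtain ⟨hQy, hQv, -⟩ := hQ t ht.2.1
  have hmove : ∀ w, w ≠ y → (Q t).point y ≠ P.point w := by
    intro w hw heq
    rw [hQy, ← Projectivization.mk_rep (P.point w), mk_eq_mk_iff_not_linearIndependent] at heq
    -- Vertices that shared the point of `y` are left behind as soon as `t ≠ 0`; the others are
    -- avoided by the choice of `t`.
    by_cases h : P.point y = P.point w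
    · rw [← h] at heq
      apply heq
      rw [LinearIndependent.pair_iff] at hq ⊢
      intro a b hab
      obtain ⟨h₁, h₂⟩ := hq (a + b) (a * t) (by rw [← hab]; module)
      have ha := (mul_eq_zero.1 h₂).resolve_right ht.1
      exact ⟨ha, by simpa [ha] using h₁⟩
    · exact heq (ht.2.2 w h)
  intro v w
  by_cases hv : v = y
  · subst hv
    rw [hy]
    by_cases hw : w = v
    · simp [hw]
    · rw [hQv w hw]
      exact iff_of_false (hmove w hw) (Ne.symm hw)
  · by_cases hw : w = y
    · subst hw
      rw [hQv v hv, Setoid.comm', hy]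
      exact iff_of_false (hmove v hv).symm (Ne.symm hv)
    · rw [hQv v hv, hQv w hw, hσ v w hv hw]
      exact hP v w

end Deformation

/-! ### Failure of maximality -/

section Maximal

variable {α β F K : Type*} [Field F] [Field K] [Algebra F K] {G : Graph α β} {d : ℕ}

/-- An infinite field supplies a distinct point `(1 : t : ... : t)` for each block, and any two
points, equal or not, lie on a common line. -/
theorem cellule_nonempty [Infinite K] [Finite V(G)] (hd : 1 ≤ d) (σ : Setoid V(G)) :
    (cellule K d σ).Nonempty := by
  obtain ⟨m, rfl⟩ : ∃ m, d = m + 1 := ⟨d - 1, by omega⟩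
  obtain ⟨φ⟩ : Nonempty (Quotient σ ↪ K) := by
    have := Fintype.ofFinite (Quotient σ)
    exact ⟨(Fintype.equivFin _).toEmbedding.trans
      (Fin.valEmbedding.trans (Infinite.natEmbedding K))⟩
  let vec : K → Fin (m + 1 + 1) → K := fun t => Fin.cons 1 (fun _ => t)
  have hvec : ∀ t, vec t ≠ 0 := fun t h => by simpa [vec] using congrFun h 0
  have hinj : ∀ s t, Projectivization.mk K (vec s) (hvec s) = Projectivization.mk K (vec t) (hvec t)
      → s = t := by
    intro s t h
    obtain ⟨a, ha⟩ := (Projectivization.mk_eq_mk_iff' K _ _ _ _).1 h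
    have h0 := congrFun ha 0
    have h1 := congrFun ha 1
    simp only [vec, Pi.smul_apply, smul_eq_mul, Fin.cons_zero, mul_one, Fin.cons_one] at h0 h1
    rw [h0, one_mul] at h1
    exact h1.symm
  let pt : V(G) → ProjPoint K (m + 1) := fun v =>
    Projectivization.mk K (vec (φ ⟦v⟧)) (hvec _)
  have hline : ∀ e : E(G), ∃ L : ProjLine K (m + 1),
      ∀ v : V(G), G.Inc e v → (pt v).submodule ≤ L.1 := by
    intro e
    obtain ⟨x, z, hxz⟩ := G.exists_isLink_of_mem_edgeSet e.2
    obtain ⟨L, hL, hx, hz⟩ := exists_plane (K := K) (M := Fin (m + 1 + 1) → K) (by simp)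
      (hvec (φ ⟦⟨x, hxz.left_mem⟩⟧)) (b := vec (φ ⟦⟨z, hxz.right_mem⟩⟧))
    refine ⟨⟨L, hL⟩, fun v hv => ?_⟩
    rw [Projectivization.submodule_mk, Submodule.span_singleton_le_iff_mem]
    rcases hv.eq_or_eq_of_isLink hxz with h | h
    · obtain rfl : v = ⟨x, hxz.left_mem⟩ := Subtype.ext h
      exact hx
    · obtain rfl : v = ⟨z, hxz.right_mem⟩ := Subtype.ext h
      exact hz
  choose L hL using hline
  refine ⟨⟨pt, L, hL⟩, fun v w => ⟨fun h => ?_, fun h => ?_⟩⟩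
  · exact Quotient.exact (φ.injective (hinj _ _ h))
  · simp only [pt, Quotient.sound (s := σ) h]

/-- In the closure of a cellule, equivalent vertices have the same point. -/
theorem point_eq_of_mem_celluleClosure {π : Setoid V(G)} {x y : V(G)} (hxy : π x y)
    {P : Picture G K d} (hP : P ∈ celluleClosure F K d π) : P.point x = P.point y := by
  by_contra hne
  obtain ⟨i, j, hij⟩ : ∃ i j, (P.point x).rep i * (P.point y).rep j
      - (P.point x).rep j * (P.point y).rep i ≠ 0 := by
    by_contra! H
    obtain ⟨j, hj⟩ := Function.ne_iff.1 (P.point y).rep_nonzero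
    apply hne
    rw [← Projectivization.mk_rep (P.point x), ← Projectivization.mk_rep (P.point y),
      Projectivization.mk_eq_mk_iff']
    refine ⟨(P.point x).rep j / (P.point y).rep j, ?_⟩
    ext i
    simp only [Pi.zero_apply] at hj
    simp only [Pi.smul_apply, smul_eq_mul]
    rw [div_mul_eq_mul_div, div_eq_iff hj]
    linear_combination -(H i j)
  let X : V(G) → Fin (d + 1) → MvPolynomial (CoordIndex G d) F := fun v i =>
    MvPolynomial.X (Sum.inl (v, i))
  let f := X x i * X y j - X x j * X y i
  have hf : IsMultihomogeneous F f := by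
    refine ⟨Finsupp.single (Sum.inl x) 1 + Finsupp.single (Sum.inl y) 1, ?_⟩
    have hX : ∀ v i, (X v i).IsWeightedHomogeneous (multidegree G d)
        (Finsupp.single (Sum.inl v) 1) := fun v i =>
      MvPolynomial.isWeightedHomogeneous_X F (multidegree G d) (Sum.inl (v, i))
    exact Submodule.sub_mem (MvPolynomial.weightedHomogeneousSubmodule F (multidegree G d) _)
      ((hX x i).mul (hX y j)) ((hX x j).mul (hX y i))
  have heval : ∀ c : CoordIndex G d → K, MvPolynomial.aeval c f =
      c (Sum.inl (x, i)) * c (Sum.inl (y, j)) - c (Sum.inl (x, j)) * c (Sum.inl (y, i)) := by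
    intro c
    simp [f, X]
  have hopen : @IsOpen _ (zariski G F K d) (zeroLocus K f)ᶜ :=
    TopologicalSpace.isOpen_generateFrom_of_mem ⟨f, hf, rfl⟩
  have hmem : P ∈ (zeroLocus K f)ᶜ := by
    -- The minor `f` ignores the lines, but refuting membership in its zero locus requires a full
    -- coordinate system.
    have hab : ∀ e : E(G), ∃ ab : (Fin (d + 1) → K) × (Fin (d + 1) → K),
        (P.line e).1 = Submodule.span K {ab.1, ab.2} := by
      intro e
      obtain ⟨a, haL, ha⟩ := Submodule.exists_mem_ne_zero_of_ne_bot (p := (P.line e).1) (by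
        intro h
        have := (P.line e).2
        rw [h] at this
        simp at this)
      obtain ⟨b, hbL, hb⟩ := exists_linearIndependent_pair (P.line e).2.ge ha
      exact ⟨(a, b), eq_span_pair (P.line e).2 hb haL hbL⟩
    choose ab hab using hab
    intro hz
    have := hz (fun k => match k with
      | Sum.inl (v, i) => (P.point v).rep i
      | Sum.inr (e, i, j) => (ab e).1 i * (ab e).2 j - (ab e).1 j * (ab e).2 i)
      ⟨fun v => ⟨(P.point v).rep_nonzero, (P.point v).mk_rep⟩,
        fun e => ⟨(ab e).1, (ab e).2, hab e, fun _ _ => rfl⟩⟩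
    rw [heval] at this
    exact hij this
  obtain ⟨R, hR, hRπ⟩ := (@mem_closure_iff _ (zariski G F K d) _ _).1 hP _ hopen hmem
  apply hR
  intro c hc
  rw [heval]
  obtain ⟨hx0, hx⟩ := hc.1 x
  obtain ⟨hy0, hy⟩ := hc.1 y
  have hRxy := (hRπ x y).2 hxy
  rw [← hx, ← hy, Projectivization.mk_eq_mk_iff'] at hRxy
  obtain ⟨a, ha⟩ := hRxy
  have hai := congrFun ha i
  have haj := congrFun ha j
  simp only [Pi.smul_apply, smul_eq_mul] at hai haj
  rw [← hai, ← haj]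
  ring

theorem not_isMaximalCellule_of_pair [Infinite K] [Finite V(G)] [Finite E(G)] (hd : 1 ≤ d)
    {π : Setoid V(G)} {x y : V(G)} (hxy : x ≠ y) (hπ : {x, y} ∈ π.classes)
    (hE : {e : β | G.IsLink e x y}.encard ≤ 1) : ¬ IsMaximalCellule F K d π := by
  classical
  intro hmax
  have hrel : ∀ v, π y v ↔ v = x ∨ v = y := by
    intro v
    have hv : ∀ u, u ∈ ({x, y} : Set V(G)) → π u y := fun u hu =>
      Setoid.rel_iff_exists_classes π |>.2 ⟨_, hπ, hu, by simp⟩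
    refine ⟨fun h => ?_, fun h => π.symm' (hv v h)⟩
    obtain ⟨B, hB, hyB, hvB⟩ := (Setoid.rel_iff_exists_classes π).1 h
    have := Setoid.eq_of_mem_classes hB hyB hπ (by simp)
    rw [this] at hvB
    exact hvB
  -- The kernel of `g` is `π` with `y` split off, `none` being its private label.
  let g : V(G) → Option (Quotient π) := fun v => if v = y then none else some ⟦v⟧
  let σ : Setoid V(G) := Setoid.ker g
  have hy : ∀ w, σ y w ↔ y = w := by
    intro w
    rw [Setoid.ker_def]
    by_cases h : w = y
    · simp [g, h]
    · simp [g, h, Ne.symm h]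
  have hσ : ∀ v w, v ≠ y → w ≠ y → (σ v w ↔ π v w) := by
    intro v w hv hw
    rw [Setoid.ker_def]
    simp only [g, hv, hw, if_false, Option.some_inj]
    exact Quotient.eq
  have hle : CelluleLE F K d π σ := by
    refine cellule_subset_celluleClosure hd hy hσ (le_trans (Set.encard_le_encard ?_) hE)
    rintro e ⟨z, hzy, hz, he⟩
    obtain rfl := ((hrel z).1 hz).resolve_right hzy
    exact he.symm
  obtain ⟨P, hP⟩ := cellule_nonempty (K := K) hd σ
  have h := point_eq_of_mem_celluleClosure (F := F) ((hrel x).2 (Or.inl rfl)) (hmax σ hle hP)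
  exact hxy ((hy x).1 ((hP y x).1 h)).symm

end Maximal

end GraphPicture

theorem mainTheorem9 {α β F K : Type*} [Field F] [Field K] [Algebra F K] [Infinite K]
    (G : Graph α β) [Finite V(G)] [Finite E(G)] (d : ℕ) (hd : 1 ≤ d) :
    (∀ (S : Set V(G)) (y : V(G)), S.Nonempty → y ∉ S →
      {e : β | ∃ x ∈ S, G.IsLink e y x}.encard ≤ 1 →
      ∀ π σ : Setoid V(G), insert y S ∈ π.classes →
        σ.classes = (π.classes \ {insert y S}) ∪ {S, {y}} →
        GraphPicture.cellule K d π ⊆ GraphPicture.celluleClosure F K d σ) ∧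
    (∀ (π : Setoid V(G)) (x y : V(G)), x ≠ y → {x, y} ∈ π.classes →
      {e : β | G.IsLink e x y}.encard ≤ 1 →
      ¬ GraphPicture.IsMaximalCellule F K d π) ∧
    (G.Simple → ∀ π : Setoid V(G), (∃ B ∈ π.classes, B.ncard = 2) →
      ¬ GraphPicture.IsMaximalCellule F K d π) := by
  refine ⟨?_, fun π x y hxy hπ hE => GraphPicture.not_isMaximalCellule_of_pair hd hxy hπ hE, ?_⟩
  · intro S y _ hyS hE π σ hπ hσ
    have hyσ : {y} ∈ σ.classes := by rw [hσ]; simp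
    have hSσ : S ∈ σ.classes := by rw [hσ]; simp
    refine GraphPicture.cellule_subset_celluleClosure hd (y := y) ?_ ?_
      (le_trans (Set.encard_le_encard ?_) hE)
    · refine fun w => ⟨fun h => ?_, fun h => h ▸ σ.refl' y⟩
      obtain ⟨B, hB, hyB, hwB⟩ := (Setoid.rel_iff_exists_classes σ).1 h
      rw [Setoid.eq_of_mem_classes hB hyB hyσ rfl] at hwB
      exact hwB.symm
    · intro v w hv hw
      rw [Setoid.rel_iff_exists_classes σ, Setoid.rel_iff_exists_classes π]
      constructor
      · rintro ⟨B, hB, hvB, hwB⟩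
        rw [hσ] at hB
        rcases hB with hB | rfl | rfl
        · exact ⟨B, hB.1, hvB, hwB⟩
        · exact ⟨_, hπ, Or.inr hvB, Or.inr hwB⟩
        · exact absurd hvB hv
      · rintro ⟨B, hB, hvB, hwB⟩
        by_cases h : B = insert y S
        · subst h
          exact ⟨S, hSσ, hvB.resolve_left hv, hwB.resolve_left hw⟩
        · exact ⟨B, by rw [hσ]; exact Or.inl ⟨hB, h⟩, hvB, hwB⟩
    · rintro e ⟨x, hxy, hx, he⟩
      obtain ⟨B, hB, hyB, hxB⟩ := (Setoid.rel_iff_exists_classes π).1 hx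
      rw [Setoid.eq_of_mem_classes hB hyB hπ (by simp)] at hxB
      exact ⟨x, hxB.resolve_left hxy, he⟩
  · rintro hG π ⟨B, hB, hB2⟩
    obtain ⟨x, y, hxy, rfl⟩ := Set.ncard_eq_two.1 hB2
    refine GraphPicture.not_isMaximalCellule_of_pair hd hxy hB (Set.encard_le_one_iff.2 ?_)
    intro e e' he he'
    exact hG.eq_of_isLink he he'
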